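/- Let $d,m\ge 0$ and $N\ge 1$ be integers, let $h>0$ and $T=Nh$, and let $b_t:\mathbb R^d\to\mathbb R^d$ and $\sigma_t:\mathbb R^d\to\mathbb R^{d\times m}$ ($t\in[0,T]$). Suppose that there are $\alpha\in\mathbb R$ and $\beta,\lambda,\Lambda>0$ such that for all $x,y\in\mathbb R^d$ and $t\in[0,T]$, $$\langle b_t(x)-b_t(y),x-y\rangle+\tfrac12\|\sigma_t(x)-\sigma_t(y)\|_{\rm HS}^2\le-\alpha\|x-y\|^2,\qquad \|b_t(x)-b_t(y)\|\le\beta\|x-y\|,\qquad \lambda I\preceq\sigma_t(x)\sigma_t(x)^{\mathsf T}\preceq\Lambda I .$$ Consider the discrete-time process $$\hat X_{(n+1)h}=\hat X_{nh}+h\,b_{nh}(\hat X_{nh})+\sqrt h\,\sigma_{nh}(\hat X_{nh})\,\xi_{nh},$$ where $(\xi_{nh})_{n\ge0}$ are i.i.d. standard Gaussian vectors in $\mathbb R^m$, and let $\hat P_h^N$ denote its $N$-step transition kernel from time $0$ to time $Nh$. Put $L^2:=1-2\alpha h+\beta^2h^2$. Then for all positive measurable functions $f:\mathbb R^d\to\mathbb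 R$ and all $x,y\in\mathbb R^d$, $$\hat P_h^Nf(x)\le\Bigl(1+\frac{4(\beta-\alpha)(\Lambda/\lambda)^3h}{L^2}\Bigr)\,\frac{\alpha-\beta^2h/2}{\lambda\,(L^{-2N}-1)}\,\|x-y\|^2+\log\hat P_h^N(\exp f)(y),$$ where both sides may be $+\infty$, and the coefficient of $\|x-y\|^2$ is read as its limit $\bigl(1+4(\beta-\alpha)(\Lambda/\lambda)^3h\bigr)\frac{1}{2\lambda hN}$ if $L^2=1$, and as $0$ if $L^2=0$. Moreover, if $0<L^2<1$, then also $$\hat P_h^Nf(x)\le\Bigl(1+\frac{4(\beta-\alpha)(\Lambda/\lambda)^3h}{L^2}\Bigr)\,\frac{\alpha\,(1-\beta h/2)}{\lambda\,(L^{-2N}-1)}\,\|x-y\|^2+\log\hat P_h^N(\exp f)(y).$$ -/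

import Mathlib

open MeasureTheory ProbabilityTheory

noncomputable section

/-- Squared Hilbert–Schmidt norm of a real matrix. -/
def hsNormSq {d m : ℕ} (A : Matrix (Fin d) (Fin m) ℝ) : ℝ :=
  ∑ i, ∑ j, A i j ^ 2

/-- One step of the Euler scheme with step size `h`, drift `b`, diffusion coefficient `σ`, from
the state `x` and with the noise `ξ`: `x + h b(x) + √h σ(x) ξ`. -/
def eulerMap {d m : ℕ} (h : ℝ) (b : EuclideanSpace ℝ (Fin d) → EuclideanSpace ℝ (Fin d))
    (σ : EuclideanSpace ℝ (Fin d) → Matrix (Fin d) (Fin m) ℝ)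
    (x : EuclideanSpace ℝ (Fin d)) (ξ : EuclideanSpace ℝ (Fin m)) : EuclideanSpace ℝ (Fin d) :=
  x + h • b x + √h • Matrix.toEuclideanLin (σ x) ξ

/-- Transition kernel of one Euler step: `x ↦ Law(x + h b(x) + √h σ(x) ξ)` with `ξ` a standard
Gaussian vector. (`Kernel.map` asks for the Euler map to be measurable, which holds for measurable
`b` and `σ`, in particular for Lipschitz ones.) -/
def eulerKernel {d m : ℕ} (h : ℝ) (b : EuclideanSpace ℝ (Fin d) → EuclideanSpace ℝ (Fin d))
    (σ : EuclideanSpace ℝ (Fin d) → Matrix (Fin d) (Fin m) ℝ) :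
    Kernel (EuclideanSpace ℝ (Fin d)) (EuclideanSpace ℝ (Fin d)) :=
  (Kernel.id ×ₖ Kernel.const (EuclideanSpace ℝ (Fin d))
    (stdGaussian (EuclideanSpace ℝ (Fin m)))).map (fun p => eulerMap h b σ p.1 p.2)

/-- The `n`-step transition kernel, from time `0` to time `n h`, of the process
`X_{(k+1)h} = X_{kh} + h b_{kh}(X_{kh}) + √h σ_{kh}(X_{kh}) ξ_{kh}` with i.i.d. standard Gaussian
vectors `ξ_{kh}`. -/
def eulerKernelIter {d m : ℕ} (h : ℝ)
    (b : ℝ → EuclideanSpace ℝ (Fin d) → EuclideanSpace ℝ (Fin d))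
    (σ : ℝ → EuclideanSpace ℝ (Fin d) → Matrix (Fin d) (Fin m) ℝ) :
    ℕ → Kernel (EuclideanSpace ℝ (Fin d)) (EuclideanSpace ℝ (Fin d))
  | 0 => Kernel.id
  | n + 1 => eulerKernel h (b (n * h)) (σ (n * h)) ∘ₖ eulerKernelIter h b σ n

/-- `L² = 1 - 2 α h + β² h²`. -/
def eulerLSq (α β h : ℝ) : ℝ := 1 - 2 * α * h + β ^ 2 * h ^ 2

/-- The constant
`(1 + 4 (β - α) (Λ/λ)³ h / L²) (α - β² h / 2) / (λ (L^{-2N} - 1))`.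
Here `α - β² h / 2 = (1 - L²) / (2 h)`, and at `L² = 1` and `L² = 0`, where the formula reads
`0 / 0` or contains `L^{-2N} = ∞`, the constant is its limit. -/
def logHarnackConst (α β lam Lam h : ℝ) (N : ℕ) : ℝ :=
  if eulerLSq α β h = 0 then 0
  else if eulerLSq α β h = 1 then
    (1 + 4 * (β - α) * (Lam / lam) ^ 3 * h) * (1 / (2 * lam * h * N))
  else
    (1 + 4 * (β - α) * (Lam / lam) ^ 3 * h / eulerLSq α β h) *
      ((α - β ^ 2 * h / 2) / (lam * ((eulerLSq α β h ^ N)⁻¹ - 1)))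

/-- The constant with the numerator `α (1 - β h / 2)`:
`(1 + 4 (β - α) (Λ/λ)³ h / L²) α (1 - β h / 2) / (λ (L^{-2N} - 1))`. -/
def logHarnackConst' (α β lam Lam h : ℝ) (N : ℕ) : ℝ :=
  (1 + 4 * (β - α) * (Lam / lam) ^ 3 * h / eulerLSq α β h) *
    ((α * (1 - β * h / 2)) / (lam * ((eulerLSq α β h ^ N)⁻¹ - 1)))

/-- `P f(x) ≤ C ‖x - y‖² + log P(exp f)(y)` for all positive measurable `f` and all `x, y`. Both
integrals are taken in `[0, ∞]` and the inequality in `[-∞, ∞]`, so no integrability is needed. -/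
def LogHarnack {d : ℕ} (P : Kernel (EuclideanSpace ℝ (Fin d)) (EuclideanSpace ℝ (Fin d)))
    (C : ℝ) : Prop :=
  ∀ f : EuclideanSpace ℝ (Fin d) → ℝ, Measurable f → (∀ z, 0 < f z) →
    ∀ x y : EuclideanSpace ℝ (Fin d),
      ((∫⁻ z, ENNReal.ofReal (f z) ∂(P x) : ENNReal) : EReal) ≤
        ((C * ‖x - y‖ ^ 2 : ℝ) : EReal) +
          ENNReal.log (∫⁻ z, ENNReal.ofReal (Real.exp (f z)) ∂(P y))

end

/-! Given its starting point, one Euler step is Gaussian. For one step the claim is thus the entropy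
inequality `∫ f dμ ≤ KL(μ ‖ ν) + log ∫ exp f dν` (`integral_affine_le_log_integral_exp`) with a
bound on the divergence of two Gaussians. The means contribute `‖x - y + h (b x - b y)‖² / (2 h λ)`
and the covariances `(Λ/λ)² / λ` times the squared Hilbert–Schmidt distance of the diffusion
coefficients (`integral_eulerKernel_le`). The assumptions on `b` and `σ` turn the sum into `C ‖x -
y‖²` with `C = eulerStepConst`.

Several steps share the cost (`BoundedLogHarnack.comp`). With `w` on the segment from `y` to `x`,
the first step pays for moving from `w` to `y`. Two copies started at `x` and `w` with the same
noise have their mean squared distance multiplied by at most `L²` (`sqContraction_eulerKernel`), and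
the later steps pay for what is left. The best `w` gives `1/Cₙ₊₁ = 1/C + 1/(L² Cₙ)`, hence `C_N = C
/ ∑_{i<N} L^{-2i}`, and the geometric sum gives the stated constant.

All this is done for bounded nonnegative `f`; monotone convergence gives the general case. -/

lemma sub_one_sub_log_le {r u : ℝ} (hr : 1 ≤ r) (hu : 0 < u) (hru : 1 ≤ r * u) :
    u - 1 - Real.log u ≤ r / 2 * (u - 1) ^ 2 := by
  rcases le_total 1 u with h | h
  · have h1 := Real.le_log_one_add_of_nonneg (x := u - 1) (by linarith)
    rw [add_sub_cancel] at h1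
    have h2 : (u - 1) - (u - 1) ^ 2 / 2 ≤ 2 * (u - 1) / (u - 1 + 2) := by
      rw [le_div_iff₀ (by linarith)]
      nlinarith [pow_nonneg (sub_nonneg.2 h) 3]
    nlinarith [sq_nonneg (u - 1)]
  -- Below `1`, the bound `t ≤ sinh t` at `t = -log u` yields exactly `u⁻¹ / 2 * (u - 1) ^ 2`, and
  -- `u⁻¹ ≤ r`.
  · have h1 : -Real.log u ≤ Real.sinh (-Real.log u) :=
      Real.self_le_sinh_iff.2 (neg_nonneg.2 (Real.log_nonpos hu.le h))
    rw [Real.sinh_eq, neg_neg, Real.exp_neg, Real.exp_log hu] at h1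
    have h2 : u⁻¹ ≤ r := (inv_le_iff_one_le_mul₀ hu).2 hru
    have h3 : u⁻¹ * u = 1 := inv_mul_cancel₀ hu.ne'
    have h4 : u - 1 + (u⁻¹ - u) / 2 = u⁻¹ / 2 * (u - 1) ^ 2 := by
      field_simp; ring
    nlinarith [mul_le_mul_of_nonneg_right h2 (sq_nonneg (u - 1))]

/-! ### Matrix inequalities: the covariance part of the Gaussian divergence. -/

section HilbertSchmidt

open Matrix

variable {d m k : ℕ}

lemma hsNormSq_nonneg (A : Matrix (Fin d) (Fin m) ℝ) : 0 ≤ hsNormSq A :=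
  Finset.sum_nonneg fun _ _ => Finset.sum_nonneg fun _ _ => sq_nonneg _

lemma hsNormSq_transpose (A : Matrix (Fin d) (Fin m) ℝ) : hsNormSq Aᵀ = hsNormSq A := by
  simp only [hsNormSq, transpose_apply]
  exact Finset.sum_comm

lemma hsNormSq_smul (c : ℝ) (A : Matrix (Fin d) (Fin m) ℝ) :
    hsNormSq (c • A) = c ^ 2 * hsNormSq A := by
  simp [hsNormSq, Finset.mul_sum, mul_pow]

lemma hsNormSq_one : hsNormSq (1 : Matrix (Fin d) (Fin d) ℝ) = d := by
  simp [hsNormSq, Matrix.one_apply]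

lemma hsNormSq_eq_trace (A : Matrix (Fin d) (Fin m) ℝ) : hsNormSq A = (A * Aᵀ).trace := by
  simp [hsNormSq, Matrix.trace, Matrix.mul_apply, sq]

lemma hsNormSq_add_le (A B : Matrix (Fin d) (Fin m) ℝ) :
    hsNormSq (A + B) ≤ 2 * hsNormSq A + 2 * hsNormSq B := by
  simp only [hsNormSq, Finset.mul_sum, ← Finset.sum_add_distrib]
  gcongr with i _ j _
  rw [Matrix.add_apply]
  nlinarith [sq_nonneg (A i j - B i j)]

lemma hsNormSq_eq_sum_dotProduct (A : Matrix (Fin d) (Fin m) ℝ) :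
    hsNormSq A = ∑ j, A.col j ⬝ᵥ A.col j := by
  rw [← hsNormSq_transpose]
  simp [hsNormSq, dotProduct, sq]

/-- `A` satisfies `‖A v‖² ≤ c ‖v‖²` for all `v`. -/
def SqOpBound (A : Matrix (Fin d) (Fin m) ℝ) (c : ℝ) : Prop :=
  ∀ v, (A *ᵥ v) ⬝ᵥ (A *ᵥ v) ≤ c * (v ⬝ᵥ v)

lemma dotProduct_self_nonneg_real (v : Fin d → ℝ) : 0 ≤ v ⬝ᵥ v :=
  Finset.sum_nonneg fun _ _ => mul_self_nonneg _

lemma dotProduct_sq_le (v w : Fin d → ℝ) : (v ⬝ᵥ w) ^ 2 ≤ (v ⬝ᵥ v) * (w ⬝ᵥ w) := by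
  simpa [dotProduct, sq] using Finset.sum_mul_sq_le_sq_mul_sq Finset.univ v w

lemma mulVec_dotProduct_mulVec_self (A : Matrix (Fin d) (Fin m) ℝ) (v : Fin m → ℝ) :
    (A *ᵥ v) ⬝ᵥ (A *ᵥ v) = v ⬝ᵥ ((Aᵀ * A) *ᵥ v) := by
  rw [← mulVec_mulVec, dotProduct_mulVec v, vecMul_transpose]

/-- For `u = Aᵀ w`, Cauchy–Schwarz gives `‖u‖⁴ = ⟨w, A u⟩² ≤ ‖w‖² c ‖u‖²`; then divide by `‖u‖²`. -/
lemma SqOpBound.transpose {A : Matrix (Fin d) (Fin m) ℝ} {c : ℝ} (hc : 0 ≤ c)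
    (hA : SqOpBound A c) : SqOpBound Aᵀ c := by
  intro w
  set u := Aᵀ *ᵥ w with hu
  have h1 : u ⬝ᵥ u = w ⬝ᵥ (A *ᵥ u) := by
    rw [dotProduct_mulVec w, ← mulVec_transpose]
  have h2 := dotProduct_sq_le w (A *ᵥ u)
  rw [← h1] at h2
  have h3 := mul_le_mul_of_nonneg_left (hA u) (dotProduct_self_nonneg_real w)
  rcases (dotProduct_self_nonneg_real u).eq_or_lt with h0 | h0
  · rw [← h0]
    exact mul_nonneg hc (dotProduct_self_nonneg_real w)
  · nlinarith

lemma SqOpBound.hsNormSq_mul_le {A : Matrix (Fin d) (Fin m) ℝ} {c : ℝ} (hA : SqOpBound A c)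
    (X : Matrix (Fin m) (Fin k) ℝ) : hsNormSq (A * X) ≤ c * hsNormSq X := by
  simp only [hsNormSq_eq_sum_dotProduct, Finset.mul_sum]
  exact Finset.sum_le_sum fun j _ => hA (X.col j)

lemma SqOpBound.hsNormSq_mul_transpose_le {A : Matrix (Fin d) (Fin m) ℝ} {c : ℝ}
    (hA : SqOpBound A c) (X : Matrix (Fin k) (Fin m) ℝ) :
    hsNormSq (X * Aᵀ) ≤ c * hsNormSq X := by
  rw [← hsNormSq_transpose, transpose_mul, transpose_transpose, ← hsNormSq_transpose X]
  exact hA.hsNormSq_mul_le _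

lemma hsNormSq_mul_transpose_sub_le {A B : Matrix (Fin d) (Fin m) ℝ} {c : ℝ}
    (hA : SqOpBound A c) (hB : SqOpBound B c) :
    hsNormSq (A * Aᵀ - B * Bᵀ) ≤ 4 * c * hsNormSq (A - B) := by
  have h : A * Aᵀ - B * Bᵀ = A * (A - B)ᵀ + (A - B) * Bᵀ := by
    rw [transpose_sub, Matrix.mul_sub, Matrix.sub_mul]; abel
  have h1 := hsNormSq_add_le (A * (A - B)ᵀ) ((A - B) * Bᵀ)
  have h2 := hA.hsNormSq_mul_le (A - B)ᵀ
  have h3 := hB.hsNormSq_mul_transpose_le (A - B)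
  rw [hsNormSq_transpose] at h2
  rw [h]
  linarith

lemma trace_mul_self_eq_sum_eigenvalues {P : Matrix (Fin d) (Fin d) ℝ} (hP : P.IsHermitian) :
    (P * P).trace = ∑ i, hP.eigenvalues i ^ 2 := by
  have hs := hP.spectral_theorem
  have hs' : P * P = hP.eigenvectorUnitary *
      (diagonal hP.eigenvalues * diagonal hP.eigenvalues) *
      star (hP.eigenvectorUnitary : Matrix (Fin d) (Fin d) ℝ) := by
    conv_lhs => rw [hs, ← map_mul]
    simp [Unitary.conjStarAlgAut_apply]
  rw [hs', trace_mul_comm, ← mul_assoc, Unitary.coe_star_mul_self, one_mul, diagonal_mul_diagonal,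
    trace_diagonal]
  simp [sq]

/-- Bound of twice the divergence between the centred Gaussians of covariances `M Mᵀ` and `1`. -/
lemma hsNormSq_sub_log_det_le {M : Matrix (Fin d) (Fin d) ℝ} {r : ℝ} (hr : 1 ≤ r)
    (hM : ∀ v, v ⬝ᵥ v ≤ r * ((Mᵀ *ᵥ v) ⬝ᵥ (Mᵀ *ᵥ v))) :
    hsNormSq M - d - 2 * Real.log |M.det| ≤ r / 2 * hsNormSq (M * Mᵀ - 1) := by
  set P := M * Mᵀ with hPdef
  have hP : P.IsHermitian := by
    simpa using isHermitian_mul_conjTranspose_self M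
  have hPt : Pᵀ = P := by simp [hPdef]
  -- The hypothesis, tested on a unit eigenvector of `M Mᵀ`, keeps the spectrum above `1 / r`. The
  -- claim is then the sum of `sub_one_sub_log_le` over the eigenvalues.
  have hev (i) : 1 ≤ r * hP.eigenvalues i := by
    have h1 := hM (hP.eigenvectorBasis i).ofLp
    rw [mulVec_dotProduct_mulVec_self, transpose_transpose, ← hPdef,
      hP.mulVec_eigenvectorBasis, dotProduct_smul] at h1
    have h2 : (hP.eigenvectorBasis i).ofLp ⬝ᵥ (hP.eigenvectorBasis i).ofLp = 1 := by
      have := hP.eigenvectorBasis.orthonormal.1 i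
      have h3 := EuclideanSpace.real_norm_sq_eq (hP.eigenvectorBasis i)
      rw [this] at h3
      simpa [dotProduct, sq] using h3.symm
    rw [h2] at h1
    simpa using h1
  have hpos (i) : 0 < hP.eigenvalues i := by
    by_contra! hc
    nlinarith [hev i]
  have hdet : 2 * Real.log |M.det| = ∑ i, Real.log (hP.eigenvalues i) := by
    rw [← Real.log_prod (fun i _ => (hpos i).ne')]
    have : P.det = ∏ i, hP.eigenvalues i := by simpa using hP.det_eq_prod_eigenvalues
    rw [← this, hPdef, det_mul, det_transpose, ← abs_mul_abs_self, ← sq, Real.log_pow]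
    simp
  have htr : P.trace = ∑ i, hP.eigenvalues i := by simpa using hP.trace_eq_sum_eigenvalues
  have hhs : hsNormSq (P - 1) = ∑ i, (hP.eigenvalues i - 1) ^ 2 := by
    rw [hsNormSq_eq_trace, transpose_sub, hPt, transpose_one, Matrix.mul_sub, Matrix.sub_mul]
    simp only [mul_one, one_mul, trace_sub, trace_mul_self_eq_sum_eigenvalues hP, htr, trace_one]
    simp only [sub_sq, Finset.sum_add_distrib, Finset.sum_sub_distrib, ← Finset.mul_sum, mul_one]
    simp
    ring
  rw [hhs, hdet, hsNormSq_eq_trace, htr, Finset.mul_sum]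
  have := Finset.sum_le_sum fun i (_ : i ∈ Finset.univ) => sub_one_sub_log_le hr (hpos i) (hev i)
  simpa [Finset.sum_sub_distrib] using this

-- A Gaussian law depends on its coefficient only through the covariance. Replacing the `d × m`
-- coefficient by a square root, invertible under ellipticity, makes any two step laws affine images
-- of each other.
open scoped MatrixOrder in
lemma exists_mul_transpose_eq (A : Matrix (Fin d) (Fin m) ℝ) :
    ∃ S : Matrix (Fin d) (Fin d) ℝ, S * Sᵀ = A * Aᵀ := by
  have h : (A * Aᵀ).PosSemidef := by simpa using posSemidef_self_mul_conjTranspose A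
  refine ⟨CFC.sqrt (A * Aᵀ), ?_⟩
  have hs : (CFC.sqrt (A * Aᵀ))ᵀ = CFC.sqrt (A * Aᵀ) := by
    have := (CFC.sqrt_nonneg (A * Aᵀ)).isSelfAdjoint.star_eq
    rwa [star_eq_conjTranspose, conjTranspose_eq_transpose_of_trivial] at this
  rw [hs, CFC.sqrt_mul_sqrt_self _ h.nonneg]

lemma le_transpose_mulVec_of_posSemidef {A : Matrix (Fin d) (Fin m) ℝ} {c : ℝ}
    (h : (A * Aᵀ - c • (1 : Matrix (Fin d) (Fin d) ℝ)).PosSemidef) (v : Fin d → ℝ) :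
    c * (v ⬝ᵥ v) ≤ (Aᵀ *ᵥ v) ⬝ᵥ (Aᵀ *ᵥ v) := by
  have := h.dotProduct_mulVec_nonneg v
  rw [mulVec_dotProduct_mulVec_self, transpose_transpose]
  simpa [sub_mulVec, smul_mulVec] using this

lemma SqOpBound.of_posSemidef {A : Matrix (Fin d) (Fin m) ℝ} {c : ℝ} (hc : 0 ≤ c)
    (h : (c • (1 : Matrix (Fin d) (Fin d) ℝ) - A * Aᵀ).PosSemidef) : SqOpBound A c := by
  rw [← transpose_transpose A]
  refine SqOpBound.transpose hc fun v => ?_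
  have := h.dotProduct_mulVec_nonneg v
  rw [mulVec_dotProduct_mulVec_self, transpose_transpose]
  simpa [sub_mulVec, smul_mulVec] using this

lemma det_ne_zero_of_le_transpose_mulVec {S : Matrix (Fin d) (Fin d) ℝ} {c : ℝ} (hc : 0 < c)
    (h : ∀ v, c * (v ⬝ᵥ v) ≤ (Sᵀ *ᵥ v) ⬝ᵥ (Sᵀ *ᵥ v)) : S.det ≠ 0 := by
  rw [← det_transpose]
  intro h0
  obtain ⟨v, hv, hv0⟩ := exists_mulVec_eq_zero_iff.2 h0
  have := h v
  rw [hv0, dotProduct_zero] at this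
  exact hv (dotProduct_self_eq_zero.1
    (le_antisymm (by nlinarith) (dotProduct_self_nonneg_real v)))

lemma SqOpBound.inv {S : Matrix (Fin d) (Fin d) ℝ} {c : ℝ} (hc : 0 < c)
    (h : ∀ v, c * (v ⬝ᵥ v) ≤ (Sᵀ *ᵥ v) ⬝ᵥ (Sᵀ *ᵥ v)) : SqOpBound S⁻¹ c⁻¹ := by
  have hS : IsUnit Sᵀ.det := by
    rw [det_transpose]; exact (det_ne_zero_of_le_transpose_mulVec hc h).isUnit
  rw [← transpose_transpose S⁻¹, transpose_nonsing_inv]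
  refine SqOpBound.transpose (inv_nonneg.2 hc.le) fun v => ?_
  have := h (Sᵀ⁻¹ *ᵥ v)
  rw [mulVec_mulVec, mul_nonsing_inv _ hS, one_mulVec] at this
  rwa [le_inv_mul_iff₀ hc]

/-- Bound of twice the divergence between centred Gaussians of covariances `S Sᵀ` and `R Rᵀ`. -/
lemma hsNormSq_inv_mul_sub_log_det_le {A B : Matrix (Fin d) (Fin m) ℝ}
    {S R : Matrix (Fin d) (Fin d) ℝ} {lam Lam : ℝ} (hlam : 0 < lam) (hle : lam ≤ Lam)
    (hS : S * Sᵀ = A * Aᵀ) (hR : R * Rᵀ = B * Bᵀ)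
    (hAl : (A * Aᵀ - lam • (1 : Matrix (Fin d) (Fin d) ℝ)).PosSemidef)
    (hBl : (B * Bᵀ - lam • (1 : Matrix (Fin d) (Fin d) ℝ)).PosSemidef)
    (hAu : (Lam • (1 : Matrix (Fin d) (Fin d) ℝ) - A * Aᵀ).PosSemidef)
    (hBu : (Lam • (1 : Matrix (Fin d) (Fin d) ℝ) - B * Bᵀ).PosSemidef) :
    hsNormSq (R⁻¹ * S) - d - 2 * Real.log |(R⁻¹ * S).det| ≤
      2 * ((Lam / lam) ^ 2 / lam) * hsNormSq (A - B) := by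
  have hLam : 0 < Lam := hlam.trans_le hle
  have hr : 1 ≤ Lam / lam := (one_le_div hlam).2 hle
  have hRl := le_transpose_mulVec_of_posSemidef (hR ▸ hBl)
  have hSl := le_transpose_mulVec_of_posSemidef (hS ▸ hAl)
  have hRu : SqOpBound R Lam := .of_posSemidef hLam.le (hR ▸ hBu)
  have hRdet : IsUnit R.det := (det_ne_zero_of_le_transpose_mulVec hlam hRl).isUnit
  have hRinv : SqOpBound R⁻¹ lam⁻¹ := .inv hlam hRl
  have hRtdet : IsUnit Rᵀ.det := by rwa [det_transpose]
  -- With `w = Rᵀ⁻¹ v`: `‖v‖² = ‖Rᵀ w‖² ≤ Λ ‖w‖² ≤ (Λ/λ) ‖Sᵀ w‖²`.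
  have key : ∀ v, v ⬝ᵥ v ≤ Lam / lam * (((R⁻¹ * S)ᵀ *ᵥ v) ⬝ᵥ ((R⁻¹ * S)ᵀ *ᵥ v)) := by
    intro v
    rw [transpose_mul, transpose_nonsing_inv, ← mulVec_mulVec]
    have h1 := hSl (Rᵀ⁻¹ *ᵥ v)
    have h2 := hRu.transpose hLam.le (Rᵀ⁻¹ *ᵥ v)
    rw [mulVec_mulVec, mul_nonsing_inv _ hRtdet, one_mulVec] at h2
    rw [div_mul_eq_mul_div, le_div_iff₀ hlam]
    nlinarith
  refine (hsNormSq_sub_log_det_le hr key).trans ?_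
  have hcov : R⁻¹ * S * (R⁻¹ * S)ᵀ - 1 = R⁻¹ * (A * Aᵀ - B * Bᵀ) * (R⁻¹)ᵀ := by
    rw [← hS, ← hR, transpose_mul, Matrix.mul_sub, Matrix.sub_mul]
    congr 1
    · simp only [mul_assoc]
    · rw [transpose_nonsing_inv, ← mul_assoc, nonsing_inv_mul _ hRdet, one_mul,
        mul_nonsing_inv _ hRtdet]
  have h1 := hRinv.hsNormSq_mul_transpose_le (R⁻¹ * (A * Aᵀ - B * Bᵀ))
  have h2 := hRinv.hsNormSq_mul_le (A * Aᵀ - B * Bᵀ)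
  have h3 := hsNormSq_mul_transpose_sub_le (.of_posSemidef hLam.le hAu)
    (SqOpBound.of_posSemidef hLam.le hBu)
  rw [hcov]
  -- The scalar inequality gives `(Λ/λ)/2`, each of the two factors `R⁻¹` gives `λ⁻¹`, and the
  -- difference of covariances gives `4Λ`.
  calc _ ≤ Lam / lam / 2 * (lam⁻¹ * (lam⁻¹ * (4 * Lam * hsNormSq (A - B)))) := by
        gcongr
        exact h1.trans (by gcongr; exact h2.trans (by gcongr))
    _ = _ := by field_simp; ring

end HilbertSchmidt

/-! ### Gaussian density, affine change of variables and the entropy inequality. -/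

section GaussianDensity

variable {E : Type*} [NormedAddCommGroup E] [InnerProductSpace ℝ E]

variable (E) in
/-- The normalizing constant `(2π)^{-n/2}` of the standard Gaussian density. -/
noncomputable def stdGaussianConst : ℝ := ((2 * Real.pi) ^ (Module.finrank ℝ E / 2 : ℝ))⁻¹

/-- The standard Gaussian density. -/
noncomputable def stdGaussianDensity (v : E) : ℝ :=
  stdGaussianConst E * Real.exp (-‖v‖ ^ 2 / 2)

lemma stdGaussianDensity_pos (v : E) : 0 < stdGaussianDensity v := by
  unfold stdGaussianDensity stdGaussianConst
  positivity

variable [MeasurableSpace E] [BorelSpace E]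

lemma measurable_stdGaussianDensity : Measurable (stdGaussianDensity : E → ℝ) := by
  unfold stdGaussianDensity
  fun_prop

variable [FiniteDimensional ℝ E]

lemma integrable_stdGaussianDensity : Integrable (stdGaussianDensity : E → ℝ) := by
  have h := (GaussianFourier.integrable_cexp_neg_mul_sq_norm_add (V := E) (b := 1 / 2)
    (by norm_num) 0 0).norm
  refine Integrable.const_mul (h.congr (.of_forall fun v => ?_)) _
  simp only [Complex.norm_exp]
  congr 1
  simp
  norm_cast
  ring

/-- Both sides have the same characteristic function. The density is what allows the change of
variables in Lebesgue measure. -/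
theorem stdGaussian_eq_withDensity :
    stdGaussian E = volume.withDensity fun v : E => ENNReal.ofReal (stdGaussianDensity v) := by
  have := isFiniteMeasure_withDensity_ofReal (μ := (volume : Measure E))
    integrable_stdGaussianDensity.hasFiniteIntegral
  refine Measure.ext_of_charFun (funext fun t => ?_)
  rw [charFun_stdGaussian, charFun_apply, integral_withDensity_eq_integral_toReal_smul
    (by have := measurable_stdGaussianDensity (E := E); fun_prop)
    (.of_forall fun _ => ENNReal.ofReal_lt_top)]
  have h1 (v : E) : (ENNReal.ofReal (stdGaussianDensity v)).toReal •
      Complex.exp (inner ℝ v t * Complex.I) = (stdGaussianConst E : ℂ) *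
        Complex.exp (-(1 / 2 : ℂ) * ‖v‖ ^ 2 + Complex.I * inner ℝ t v) := by
    rw [ENNReal.toReal_ofReal (stdGaussianDensity_pos v).le, stdGaussianDensity, Complex.real_smul,
      Complex.exp_add, real_inner_comm]
    push_cast
    rw [mul_assoc, mul_comm Complex.I]
    congr 3
    ring
  simp_rw [h1]
  rw [integral_const_mul, GaussianFourier.integral_cexp_neg_mul_sq_norm_add (by norm_num),
    ← mul_assoc, stdGaussianConst]
  have h2 : ((Real.pi : ℂ) / (1 / 2)) ^ (Module.finrank ℝ E / 2 : ℂ) =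
      (((2 * Real.pi) ^ (Module.finrank ℝ E / 2 : ℝ) : ℝ) : ℂ) := by
    rw [Complex.ofReal_cpow (by positivity)]
    push_cast
    congr 1
    ring
  rw [h2, ← Complex.ofReal_mul, inv_mul_cancel₀ (by positivity)]
  simp
  ring_nf

/-- The Radon–Nikodym weight of the standard Gaussian against its image under the affine map
`v ↦ c + A v`, read in the coordinate `v`. -/
noncomputable def gaussianWeight (A : E →ₗ[ℝ] E) (c v : E) : ℝ :=
  |LinearMap.det A| * Real.exp (‖v‖ ^ 2 / 2 - ‖c + A v‖ ^ 2 / 2)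

lemma measurable_gaussianWeight (A : E →ₗ[ℝ] E) (c : E) : Measurable (gaussianWeight A c) := by
  have := A.continuous_of_finiteDimensional.measurable
  unfold gaussianWeight
  fun_prop

lemma lintegral_stdGaussian_eq_affine {A : E →ₗ[ℝ] E} (hA : LinearMap.det A ≠ 0) (c : E)
    {φ : E → ENNReal} (hφ : Measurable φ) :
    ∫⁻ v, φ v ∂(stdGaussian E) =
      ∫⁻ v, ENNReal.ofReal (gaussianWeight A c v) * φ (c + A v) ∂(stdGaussian E) := by
  have hρ : Measurable fun v : E => ENNReal.ofReal (stdGaussianDensity v) :=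
    measurable_stdGaussianDensity.ennreal_ofReal
  have hAm := A.continuous_of_finiteDimensional.measurable
  have hw := measurable_gaussianWeight A c
  have hdet : 0 < |LinearMap.det A| := abs_pos.2 hA
  rw [stdGaussian_eq_withDensity, lintegral_withDensity_eq_lintegral_mul _ hρ hφ,
    lintegral_withDensity_eq_lintegral_mul _ hρ (by fun_prop)]
  have hmap := Measure.map_linearMap_addHaar_eq_smul_addHaar (volume : Measure E) hA
  rw [← lintegral_add_left_eq_self _ c]
  have h1 : (volume : Measure E) = ENNReal.ofReal |LinearMap.det A| • Measure.map A volume := by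
    rw [hmap, smul_smul, ← ENNReal.ofReal_mul hdet.le, abs_inv, mul_inv_cancel₀ hdet.ne']
    simp
  conv_lhs => rw [h1]
  rw [lintegral_smul_measure, lintegral_map (by fun_prop) hAm, smul_eq_mul,
    ← lintegral_const_mul _ (by fun_prop)]
  refine lintegral_congr fun v => ?_
  simp only [Pi.mul_apply]
  rw [← mul_assoc, ← mul_assoc, ← ENNReal.ofReal_mul hdet.le,
    ← ENNReal.ofReal_mul (stdGaussianDensity_pos v).le]
  congr 2
  simp only [stdGaussianDensity, gaussianWeight]
  have : Real.exp (-‖c + A v‖ ^ 2 / 2) =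
      Real.exp (-‖v‖ ^ 2 / 2) * Real.exp (‖v‖ ^ 2 / 2 - ‖c + A v‖ ^ 2 / 2) := by
    rw [← Real.exp_add]; congr 1; ring
  rw [this]
  ring

lemma integrable_norm_sq_stdGaussian : Integrable (fun v : E => ‖v‖ ^ 2) (stdGaussian E) :=
  (IsGaussian.memLp_two_id (μ := stdGaussian E)).integrable_norm_pow (by norm_num)

lemma integrable_norm_sq_affine_stdGaussian {F : Type*} [NormedAddCommGroup F]
    [InnerProductSpace ℝ F] (A : E →ₗ[ℝ] F) (c : F) :
    Integrable (fun v : E => ‖c + A v‖ ^ 2) (stdGaussian E) := by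
  have h : MemLp (fun v : E => c + A.toContinuousLinearMap v) 2 (stdGaussian E) :=
    (memLp_const c).add (A.toContinuousLinearMap.comp_memLp'
      (IsGaussian.memLp_two_id (μ := stdGaussian E)))
  exact h.integrable_norm_pow (by norm_num)

/-- Entropy inequality between the image of the standard Gaussian by an affine map and the standard
Gaussian. -/
theorem integral_affine_le_log_integral_exp {A : E →ₗ[ℝ] E} (hA : LinearMap.det A ≠ 0) (c : E)
    {G : E → ℝ} (hG : Measurable G) {K : ℝ} (hGK : ∀ v, |G v| ≤ K) :
    ∫ v, G (c + A v) ∂(stdGaussian E) ≤ Real.log (∫ v, Real.exp (G v) ∂(stdGaussian E)) +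
      ((∫ v, ‖c + A v‖ ^ 2 ∂(stdGaussian E) - ∫ v, ‖v‖ ^ 2 ∂(stdGaussian E)) / 2
        - Real.log |LinearMap.det A|) := by
  set γ := stdGaussian E
  have hAm := A.continuous_of_finiteDimensional.measurable
  have hdet : 0 < |LinearMap.det A| := abs_pos.2 hA
  -- `u` is `G(c + A v)` plus the logarithm of `gaussianWeight`. The weight makes `∫ exp u = ∫ exp
  -- G`, while `∫ u` is `∫ G(c + A v)` minus the relative entropy, so Jensen's inequality for `exp`
  -- is the claim.
  set u : E → ℝ := fun v => G (c + A v) +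
    (Real.log |LinearMap.det A| + (‖v‖ ^ 2 / 2 - ‖c + A v‖ ^ 2 / 2)) with hu
  have hexpu (v) : Real.exp (u v) = gaussianWeight A c v * Real.exp (G (c + A v)) := by
    simp only [hu, gaussianWeight, Real.exp_add, Real.exp_log hdet]
    ring
  have i1 : Integrable (fun v => G (c + A v)) γ :=
    Integrable.of_bound
      (hG.comp (by fun_prop : Measurable fun v => c + A v)).aestronglyMeasurable K (.of_forall fun v => hGK _)
  have i2 : Integrable (fun v : E => ‖v‖ ^ 2) γ := integrable_norm_sq_stdGaussian
  have i3 : Integrable (fun v : E => ‖c + A v‖ ^ 2) γ := integrable_norm_sq_affine_stdGaussian A c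
  have i4 : Integrable (fun v => ‖v‖ ^ 2 / 2 - ‖c + A v‖ ^ 2 / 2) γ :=
    (i2.div_const 2).sub (i3.div_const 2)
  have i5 : Integrable (fun v => Real.log |LinearMap.det A| +
      (‖v‖ ^ 2 / 2 - ‖c + A v‖ ^ 2 / 2)) γ := (integrable_const _).add i4
  have iu : Integrable u γ := i1.add i5
  have iG : Integrable (fun v => Real.exp (G v)) γ :=
    Integrable.of_bound (by fun_prop) (Real.exp K) (.of_forall fun v => by
      rw [Real.norm_of_nonneg (Real.exp_pos _).le]
      exact Real.exp_le_exp.2 ((le_abs_self _).trans (hGK v)))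
  have hlin : ∫⁻ v, ENNReal.ofReal (Real.exp (u v)) ∂γ =
      ∫⁻ v, ENNReal.ofReal (Real.exp (G v)) ∂γ := by
    rw [lintegral_stdGaussian_eq_affine hA c (φ := fun v => ENNReal.ofReal (Real.exp (G v)))
      (by fun_prop)]
    refine lintegral_congr fun v => ?_
    rw [hexpu, ENNReal.ofReal_mul]
    unfold gaussianWeight
    positivity
  have hum : Measurable u := by fun_prop
  have ieu : Integrable (fun v => Real.exp (u v)) γ := by
    refine (lintegral_ofReal_ne_top_iff_integrable (by fun_prop)
      (.of_forall fun v => (Real.exp_pos _).le)).1 ?_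
    rw [hlin]
    exact (lintegral_ofReal_ne_top_iff_integrable (by fun_prop)
      (.of_forall fun v => (Real.exp_pos _).le)).2 iG
  have heq : ∫ v, Real.exp (u v) ∂γ = ∫ v, Real.exp (G v) ∂γ := by
    rw [integral_eq_lintegral_of_nonneg_ae (.of_forall fun v => (Real.exp_pos _).le) (by fun_prop),
      integral_eq_lintegral_of_nonneg_ae (.of_forall fun v => (Real.exp_pos _).le) (by fun_prop),
      hlin]
  have hJ : Real.exp (∫ v, u v ∂γ) ≤ ∫ v, Real.exp (u v) ∂γ :=
    convexOn_exp.map_integral_le Real.continuous_exp.continuousOn isClosed_univ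
      (.of_forall fun _ => Set.mem_univ _) iu ieu
  rw [heq] at hJ
  have hlog : ∫ v, u v ∂γ ≤ Real.log (∫ v, Real.exp (G v) ∂γ) :=
    (Real.le_log_iff_exp_le ((Real.exp_pos _).trans_le hJ)).2 hJ
  have hval : ∫ v, u v ∂γ = ∫ v, G (c + A v) ∂γ + (Real.log |LinearMap.det A| +
      ((∫ v, ‖v‖ ^ 2 ∂γ) / 2 - (∫ v, ‖c + A v‖ ^ 2 ∂γ) / 2)) := by
    rw [hu, integral_add i1 i5, integral_add (integrable_const _) i4,
      integral_sub (i2.div_const 2) (i3.div_const 2), integral_div, integral_div]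
    simp
  linarith

end GaussianDensity

/-! ### Linear images of Gaussian vectors: laws and second moments. -/

section EuclideanGaussian

open Matrix

variable {d m k : ℕ}

lemma stdGaussian_map_toEuclideanLin_eq {A : Matrix (Fin d) (Fin m) ℝ}
    {B : Matrix (Fin d) (Fin k) ℝ} (h : A * Aᵀ = B * Bᵀ) :
    (stdGaussian (EuclideanSpace ℝ (Fin m))).map (toEuclideanLin A) =
      (stdGaussian (EuclideanSpace ℝ (Fin k))).map (toEuclideanLin B) := by
  have key {n : ℕ} (C : Matrix (Fin d) (Fin n) ℝ) (t : EuclideanSpace ℝ (Fin d)) :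
      charFun ((stdGaussian (EuclideanSpace ℝ (Fin n))).map (toEuclideanLin C)) t =
        Complex.exp (-((t.ofLp ⬝ᵥ ((C * Cᵀ) *ᵥ t.ofLp) : ℝ) : ℂ) / 2) := by
    have hm := (toEuclideanLin C).continuous_of_finiteDimensional.measurable
    rw [charFun_apply, integral_map (by fun_prop) (by fun_prop)]
    have h1 (v : EuclideanSpace ℝ (Fin n)) :
        inner ℝ (toEuclideanLin C v) t = inner ℝ v (toEuclideanLin Cᵀ t) := by
      simp only [EuclideanSpace.inner_eq_star_dotProduct, ofLp_toLpLin, toLin'_apply, star_trivial]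
      rw [dotProduct_mulVec, ← mulVec_transpose]
    simp_rw [h1]
    rw [← charFun_apply, charFun_stdGaussian]
    congr 3
    norm_cast
    rw [EuclideanSpace.real_norm_sq_eq, ← transpose_transpose C, transpose_transpose Cᵀ,
      ← mulVec_dotProduct_mulVec_self]
    simp [dotProduct, sq]
  have := Measure.isProbabilityMeasure_map (μ := stdGaussian (EuclideanSpace ℝ (Fin m)))
    (toEuclideanLin A).continuous_of_finiteDimensional.measurable.aemeasurable
  have := Measure.isProbabilityMeasure_map (μ := stdGaussian (EuclideanSpace ℝ (Fin k)))
    (toEuclideanLin B).continuous_of_finiteDimensional.measurable.aemeasurable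
  refine Measure.ext_of_charFun (funext fun t => ?_)
  rw [key, key, h]

lemma integral_norm_sq_affine_stdGaussian (A : Matrix (Fin d) (Fin m) ℝ)
    (c : EuclideanSpace ℝ (Fin d)) :
    ∫ v, ‖c + toEuclideanLin A v‖ ^ 2 ∂(stdGaussian (EuclideanSpace ℝ (Fin m))) =
      ‖c‖ ^ 2 + hsNormSq A := by
  set γ := stdGaussian (EuclideanSpace ℝ (Fin m))
  let ℓ (i : Fin d) : StrongDual ℝ (EuclideanSpace ℝ (Fin m)) := innerSL ℝ (WithLp.toLp 2 (A i))
  have hℓ (i v) : (toEuclideanLin A v) i = ℓ i v := by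
    simp [ℓ, mulVec, PiLp.inner_apply, dotProduct, mul_comm]
  have hL (i) : MemLp (ℓ i) 2 γ := (ℓ i).comp_memLp' (IsGaussian.memLp_two_id (μ := γ))
  have hmean (i) : ∫ v, ℓ i v ∂γ = 0 := integral_strongDual_stdGaussian (ℓ i)
  have hsq (i) : ∫ v, ℓ i v ^ 2 ∂γ = ∑ j, A i j ^ 2 := by
    have h1 := variance_dual_stdGaussian (ℓ i)
    rw [variance_of_integral_eq_zero (by fun_prop) (hmean i)] at h1
    rw [h1, innerSL_apply_norm, EuclideanSpace.real_norm_sq_eq]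
  have hexp (v) : ‖c + toEuclideanLin A v‖ ^ 2 =
      ∑ i, (c i ^ 2 + (2 * c i * ℓ i v + ℓ i v ^ 2)) := by
    rw [EuclideanSpace.real_norm_sq_eq]
    refine Finset.sum_congr rfl fun i _ => ?_
    rw [PiLp.add_apply, hℓ]
    ring
  have i1 (i) : Integrable (fun v => 2 * c i * ℓ i v) γ :=
    ((hL i).integrable (by norm_num)).const_mul _
  have i2 (i) : Integrable (fun v => ℓ i v ^ 2) γ := (hL i).integrable_sq
  have i3 (i) : Integrable (fun v => 2 * c i * ℓ i v + ℓ i v ^ 2) γ := (i1 i).add (i2 i)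
  have i4 (i) : Integrable (fun v => c i ^ 2 + (2 * c i * ℓ i v + ℓ i v ^ 2)) γ :=
    (integrable_const _).add (i3 i)
  simp_rw [hexp]
  rw [integral_finsetSum _ fun i _ => i4 i]
  rw [EuclideanSpace.real_norm_sq_eq, hsNormSq, ← Finset.sum_add_distrib]
  refine Finset.sum_congr rfl fun i _ => ?_
  rw [integral_add (integrable_const _) (i3 i), integral_add (i1 i) (i2 i),
    integral_const_mul, hmean, hsq]
  simp

end EuclideanGaussian

/-! ### Composition of log-Harnack inequalities and removal of boundedness. -/

section BoundedHarnack

variable {d : ℕ}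

/-- The log-Harnack inequality for bounded nonnegative functions. -/
def BoundedLogHarnack (P : Kernel (EuclideanSpace ℝ (Fin d)) (EuclideanSpace ℝ (Fin d)))
    (C : ℝ) : Prop :=
  ∀ (f : EuclideanSpace ℝ (Fin d) → ℝ) (K : ℝ), Measurable f → (∀ z, 0 ≤ f z) → (∀ z, f z ≤ K) →
    ∀ x y : EuclideanSpace ℝ (Fin d),
      ∫ z, f z ∂(P x) ≤ C * ‖x - y‖ ^ 2 + Real.log (∫ z, Real.exp (f z) ∂(P y))

/-- Contraction of squared distances, by the factor `q`, under some coupling. -/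
def SqContraction (P : Kernel (EuclideanSpace ℝ (Fin d)) (EuclideanSpace ℝ (Fin d)))
    (q : ℝ) : Prop :=
  ∀ x y : EuclideanSpace ℝ (Fin d),
    ∃ π : Measure (EuclideanSpace ℝ (Fin d) × EuclideanSpace ℝ (Fin d)),
      π.map Prod.fst = P x ∧ π.map Prod.snd = P y ∧
      Integrable (fun p => ‖p.1 - p.2‖ ^ 2) π ∧ ∫ p, ‖p.1 - p.2‖ ^ 2 ∂π ≤ q * ‖x - y‖ ^ 2

lemma integrable_of_nonneg_of_le {X : Type*} [MeasurableSpace X] {μ : Measure X}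
    [IsFiniteMeasure μ] {f : X → ℝ} {K : ℝ} (hf : Measurable f) (h0 : ∀ z, 0 ≤ f z)
    (hK : ∀ z, f z ≤ K) : Integrable f μ :=
  Integrable.of_bound hf.aestronglyMeasurable K
    (.of_forall fun z => by rw [Real.norm_of_nonneg (h0 z)]; exact hK z)

lemma integral_mem_Icc_of_forall_mem_Icc {X : Type*} [MeasurableSpace X] {μ : Measure X}
    [IsProbabilityMeasure μ] {f : X → ℝ} {a K : ℝ} (hf : Measurable f) (h : ∀ z, f z ∈ Set.Icc a K) :
    ∫ z, f z ∂μ ∈ Set.Icc a K := by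
  have hi : Integrable f μ := Integrable.of_bound hf.aestronglyMeasurable (max |a| |K|)
    (.of_forall fun z => abs_le_max_abs_abs (h z).1 (h z).2)
  constructor
  · simpa using integral_mono (μ := μ) (integrable_const a) hi fun z => (h z).1
  · simpa using integral_mono (μ := μ) hi (integrable_const K) fun z => (h z).2

theorem BoundedLogHarnack.comp
    {P Q : Kernel (EuclideanSpace ℝ (Fin d)) (EuclideanSpace ℝ (Fin d))}
    [IsMarkovKernel P] [IsMarkovKernel Q] {C D q : ℝ} (hP : BoundedLogHarnack P C)
    (hPq : SqContraction P q) (hQ : BoundedLogHarnack Q D) (hD : 0 ≤ D) (η : ℝ) :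
    BoundedLogHarnack (Q ∘ₖ P) (D * q * (1 - η) ^ 2 + C * η ^ 2) := by
  intro f K hf h0 hK x y
  -- `η` is the share of the displacement left to the first kernel `P`; the share `1 - η` is
  -- contracted by the coupling and then paid by `Q`.
  set w := y + η • (x - y) with hw
  obtain ⟨π, hπ1, hπ2, hπi, hπ⟩ := hPq x w
  have : IsProbabilityMeasure (π.map Prod.fst) := by rw [hπ1]; infer_instance
  have : IsProbabilityMeasure π := Measure.isProbabilityMeasure_of_map Prod.fst
  have hexpI (z) : Real.exp (f z) ∈ Set.Icc 1 (Real.exp K) :=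
    ⟨Real.one_le_exp (h0 z), Real.exp_le_exp.2 (hK z)⟩
  have hexpm : Measurable fun z => Real.exp (f z) := by fun_prop
  set F : EuclideanSpace ℝ (Fin d) → ℝ := fun z => ∫ v, f v ∂(Q z) with hF
  set H : EuclideanSpace ℝ (Fin d) → ℝ := fun z => ∫ v, Real.exp (f v) ∂(Q z) with hH
  have hFm : Measurable F := (hf.stronglyMeasurable.integral_kernel).measurable
  have hHm : Measurable H := (hexpm.stronglyMeasurable.integral_kernel).measurable
  have hFI (z) : F z ∈ Set.Icc 0 K :=
    integral_mem_Icc_of_forall_mem_Icc hf fun v => ⟨h0 v, hK v⟩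
  have hHI (z) : H z ∈ Set.Icc 1 (Real.exp K) := integral_mem_Icc_of_forall_mem_Icc hexpm hexpI
  have hHpos (z) : 0 < H z := zero_lt_one.trans_le (hHI z).1
  -- The test function for `P` is `log Q(exp f)`: it bounds `Q f` up to the cost `D`, and `P(exp g)
  -- = (Q ∘ₖ P)(exp f)`.
  set g : EuclideanSpace ℝ (Fin d) → ℝ := fun z => Real.log (H z) with hg
  have hgm : Measurable g := by fun_prop
  have hg0 (z) : 0 ≤ g z := Real.log_nonneg (hHI z).1
  have hgK (z) : g z ≤ K := (Real.log_le_iff_le_exp (hHpos z)).2 (hHI z).2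
  have e1 : ∫ z, f z ∂((Q ∘ₖ P) x) = ∫ p, F p.1 ∂π := by
    rw [Kernel.integral_comp (integrable_of_nonneg_of_le hf h0 hK), ← hπ1,
      integral_map (by fun_prop) hFm.aestronglyMeasurable]
  have e2 : ∫ z, g z ∂(P w) = ∫ p, g p.2 ∂π := by
    rw [← hπ2, integral_map (by fun_prop) hgm.aestronglyMeasurable]
  have e3 : ∫ z, Real.exp (f z) ∂((Q ∘ₖ P) y) = ∫ z, Real.exp (g z) ∂(P y) := by
    rw [Kernel.integral_comp
      (integrable_of_nonneg_of_le hexpm (fun z => (Real.exp_pos _).le) fun z => (hexpI z).2)]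
    exact integral_congr_ae (.of_forall fun z => (Real.exp_log (hHpos z)).symm)
  have iF : Integrable (fun p : _ × _ => F p.1) π :=
    integrable_of_nonneg_of_le (by fun_prop) (fun p => (hFI p.1).1) (fun p => (hFI p.1).2)
  have ig : Integrable (fun p : _ × _ => g p.2) π :=
    integrable_of_nonneg_of_le (by fun_prop) (fun p => hg0 p.2) (fun p => hgK p.2)
  have s1 : ∫ p, F p.1 ∂π ≤ D * ∫ p, ‖p.1 - p.2‖ ^ 2 ∂π + ∫ p, g p.2 ∂π := by
    rw [← integral_const_mul, ← integral_add (hπi.const_mul D) ig]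
    exact integral_mono iF ((hπi.const_mul D).add ig) fun p => hQ f K hf h0 hK p.1 p.2
  have s2 := hP g K hgm hg0 hgK w y
  have n1 : ‖x - w‖ ^ 2 = (1 - η) ^ 2 * ‖x - y‖ ^ 2 := by
    have : x - w = (1 - η) • (x - y) := by rw [hw]; module
    rw [this, norm_smul, mul_pow, Real.norm_eq_abs, sq_abs]
  have n2 : ‖w - y‖ ^ 2 = η ^ 2 * ‖x - y‖ ^ 2 := by
    have : w - y = η • (x - y) := by rw [hw]; module
    rw [this, norm_smul, mul_pow, Real.norm_eq_abs, sq_abs]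
  rw [n1] at hπ
  rw [n2, e2] at s2
  rw [e1, e3]
  have := mul_le_mul_of_nonneg_left hπ hD
  linarith

theorem BoundedLogHarnack.logHarnack
    {P : Kernel (EuclideanSpace ℝ (Fin d)) (EuclideanSpace ℝ (Fin d))} [IsMarkovKernel P]
    {C : ℝ} (hP : BoundedLogHarnack P C) : LogHarnack P C := by
  intro f hf h0 x y
  set I := ∫⁻ z, ENNReal.ofReal (Real.exp (f z)) ∂(P y) with hI
  rcases eq_or_ne I ⊤ with htop | htop
  · rw [htop, ENNReal.log_top, EReal.coe_add_top]
    exact le_top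
  have hexpi : Integrable (fun z => Real.exp (f z)) (P y) :=
    (lintegral_ofReal_ne_top_iff_integrable (by fun_prop)
      (.of_forall fun v => (Real.exp_pos _).le)).1 htop
  have hexp1 : 1 ≤ ∫ z, Real.exp (f z) ∂(P y) := by
    simpa using integral_mono (μ := P y) (integrable_const 1) hexpi
      fun z => Real.one_le_exp (h0 z).le
  have hIr : I = ENNReal.ofReal (∫ z, Real.exp (f z) ∂(P y)) :=
    (ofReal_integral_eq_lintegral_ofReal hexpi (.of_forall fun v => (Real.exp_pos _).le)).symm
  rw [hIr, ENNReal.log_ofReal_of_pos (by linarith), ← EReal.coe_add]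
  set R := C * ‖x - y‖ ^ 2 + Real.log (∫ z, Real.exp (f z) ∂(P y)) with hR
  have hfn (n : ℕ) : Measurable fun z => min (f z) n := by fun_prop
  have hfn0 (n : ℕ) (z) : 0 ≤ min (f z) n := le_min (h0 z).le n.cast_nonneg
  have hn (n : ℕ) : ∫ z, min (f z) n ∂(P x) ≤ R := by
    refine (hP _ n (hfn n) (hfn0 n) (fun z => min_le_right _ _) x y).trans ?_
    have hi : Integrable (fun z => Real.exp (min (f z) n)) (P y) :=
      integrable_of_nonneg_of_le (by fun_prop) (fun z => (Real.exp_pos _).le)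
        (fun z => Real.exp_le_exp.2 (min_le_right _ _))
    rw [hR]
    refine add_le_add le_rfl (Real.log_le_log ?_ (integral_mono hi hexpi fun z =>
      Real.exp_le_exp.2 (min_le_left _ _)))
    have : (1 : ℝ) ≤ ∫ z, Real.exp (min (f z) n) ∂(P y) := by
      simpa using integral_mono (μ := P y) (integrable_const 1) hi
        fun z => Real.one_le_exp (hfn0 n z)
    linarith
  -- `C` may be negative. The truncation at level `0` shows that `R` survives the passage through
  -- `ENNReal.ofReal`.
  have hR0 : 0 ≤ R := (integral_nonneg (hfn0 0)).trans (hn 0)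
  have hsup : ∫⁻ z, ENNReal.ofReal (f z) ∂(P x) ≤ ENNReal.ofReal R := by
    have hs (z) : ENNReal.ofReal (f z) = ⨆ n : ℕ, ENNReal.ofReal (min (f z) n) := by
      refine le_antisymm ?_ (iSup_le fun n => ENNReal.ofReal_le_ofReal (min_le_left _ _))
      obtain ⟨n, hn⟩ := exists_nat_ge (f z)
      exact le_iSup_of_le n (by rw [min_eq_left hn])
    simp_rw [hs]
    rw [lintegral_iSup (fun n => (hfn n).ennreal_ofReal)]
    · refine iSup_le fun n => ?_
      rw [← ofReal_integral_eq_lintegral_ofReal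
        (integrable_of_nonneg_of_le (hfn n) (hfn0 n) fun z => min_le_right _ _)
        (.of_forall (hfn0 n))]
      exact ENNReal.ofReal_le_ofReal (hn n)
    · intro a b hab z
      exact ENNReal.ofReal_le_ofReal (min_le_min_left _ (Nat.cast_le.2 hab))
  calc _ ≤ ((ENNReal.ofReal R : ENNReal) : EReal) := by exact_mod_cast hsup
    _ = _ := by rw [EReal.coe_ennreal_ofReal, max_eq_left hR0]

lemma LogHarnack.mono {P : Kernel (EuclideanSpace ℝ (Fin d)) (EuclideanSpace ℝ (Fin d))}
    {C D : ℝ} (hP : LogHarnack P C) (hCD : C ≤ D) : LogHarnack P D := by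
  intro f hf h0 x y
  refine (hP f hf h0 x y).trans ?_
  gcongr

/-! ### Iteration along a time-inhomogeneous chain. -/

/-- The `n`-step kernel of a time-inhomogeneous Markov chain. -/
noncomputable def kernelIter {X : Type*} [MeasurableSpace X] (K : ℕ → Kernel X X) : ℕ → Kernel X X
  | 0 => Kernel.id
  | n + 1 => K n ∘ₖ kernelIter K n

/-- The recursion for the constants adds a step at the start of the chain, which shifts the
remaining kernels in time. -/
lemma kernelIter_succ' {X : Type*} [MeasurableSpace X] (K : ℕ → Kernel X X) (n : ℕ) :
    kernelIter K (n + 1) = kernelIter (fun i => K (i + 1)) n ∘ₖ K 0 := by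
  induction n with
  | zero => simp [kernelIter]
  | succ n ih =>
    rw [kernelIter, ih, kernelIter, Kernel.comp_assoc]

lemma isMarkovKernel_kernelIter {X : Type*} [MeasurableSpace X] {K : ℕ → Kernel X X} {n : ℕ}
    (hK : ∀ i < n, IsMarkovKernel (K i)) : IsMarkovKernel (kernelIter K n) := by
  induction n with
  | zero => rw [kernelIter]; infer_instance
  | succ n ih =>
    have := ih fun i hi => hK i (by omega)
    have := hK n (by omega)
    rw [kernelIter]; infer_instance

/-- Taking `η = 1` lets the first step pay everything, so the factor `q` disappears. This serves the
case `L² = 0`, where `q⁻¹` is meaningless. -/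
theorem BoundedLogHarnack.kernelIter_same {q C : ℝ} (hC : 0 ≤ C) (n : ℕ)
    {K : ℕ → Kernel (EuclideanSpace ℝ (Fin d)) (EuclideanSpace ℝ (Fin d))}
    (hM : ∀ i < n + 1, IsMarkovKernel (K i)) (hH : ∀ i < n + 1, BoundedLogHarnack (K i) C)
    (hq : ∀ i < n + 1, SqContraction (K i) q) :
    BoundedLogHarnack (kernelIter K (n + 1)) C := by
  induction n generalizing K with
  | zero => simpa [kernelIter] using hH 0 (by omega)
  | succ n ih =>
    have hn := ih (K := fun i => K (i + 1)) (fun i hi => hM _ (by omega))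
      (fun i hi => hH _ (by omega)) (fun i hi => hq _ (by omega))
    have := hM 0 (by omega)
    have := isMarkovKernel_kernelIter (K := fun i => K (i + 1)) (n := n + 1)
      (fun i hi => hM _ (by omega))
    rw [kernelIter_succ']
    simpa using (hH 0 (by omega)).comp (hq 0 (by omega)) hn hC 1

theorem BoundedLogHarnack.kernelIter {q C : ℝ} (hq0 : 0 < q) (hC : 0 ≤ C) (n : ℕ)
    {K : ℕ → Kernel (EuclideanSpace ℝ (Fin d)) (EuclideanSpace ℝ (Fin d))}
    (hM : ∀ i < n + 1, IsMarkovKernel (K i)) (hH : ∀ i < n + 1, BoundedLogHarnack (K i) C)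
    (hq : ∀ i < n + 1, SqContraction (K i) q) :
    BoundedLogHarnack (kernelIter K (n + 1)) (C / ∑ i ∈ Finset.range (n + 1), q⁻¹ ^ i) := by
  induction n generalizing K with
  | zero => simpa [_root_.kernelIter] using hH 0 (by omega)
  | succ n ih =>
    have hn := ih (K := fun i => K (i + 1)) (fun i hi => hM _ (by omega))
      (fun i hi => hH _ (by omega)) (fun i hi => hq _ (by omega))
    have := hM 0 (by omega)
    have := isMarkovKernel_kernelIter (K := fun i => K (i + 1)) (n := n + 1)
      (fun i hi => hM _ (by omega))
    rw [kernelIter_succ']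
    set s := ∑ i ∈ Finset.range (n + 1), q⁻¹ ^ i with hs
    have hspos : 0 < s := Finset.sum_pos (fun i _ => by positivity) (by simp)
    have hs' : ∑ i ∈ Finset.range (n + 1 + 1), q⁻¹ ^ i = 1 + q⁻¹ * s := by
      rw [Finset.sum_range_succ', hs, Finset.mul_sum, add_comm]
      simp [pow_succ']
    rw [hs']
    -- This `η` minimises `(C / s) q (1 - η)² + C η²`, with minimum `C / (1 + q⁻¹ s)`.
    have h := (hH 0 (by omega)).comp (hq 0 (by omega)) hn (by positivity) (1 / (1 + q⁻¹ * s))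
    convert h using 1
    field_simp
    ring

end BoundedHarnack

/-! ### One Euler step: entropy cost and synchronous coupling. -/

section Euler

open Matrix

variable {d m : ℕ}

lemma eulerKernel_apply {h : ℝ} {b : EuclideanSpace ℝ (Fin d) → EuclideanSpace ℝ (Fin d)}
    {σ : EuclideanSpace ℝ (Fin d) → Matrix (Fin d) (Fin m) ℝ}
    (hm : Measurable fun p : EuclideanSpace ℝ (Fin d) × EuclideanSpace ℝ (Fin m) =>
      eulerMap h b σ p.1 p.2) (x : EuclideanSpace ℝ (Fin d)) :
    eulerKernel h b σ x = (stdGaussian (EuclideanSpace ℝ (Fin m))).map (eulerMap h b σ x) := by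
  rw [eulerKernel, Kernel.map_apply _ hm, Kernel.prod_apply, Kernel.id_apply, Kernel.const_apply,
    Measure.dirac_prod, Measure.map_map hm (by fun_prop)]
  rfl

lemma isMarkovKernel_eulerKernel {h : ℝ} {b : EuclideanSpace ℝ (Fin d) → EuclideanSpace ℝ (Fin d)}
    {σ : EuclideanSpace ℝ (Fin d) → Matrix (Fin d) (Fin m) ℝ}
    (hm : Measurable fun p : EuclideanSpace ℝ (Fin d) × EuclideanSpace ℝ (Fin m) =>
      eulerMap h b σ p.1 p.2) : IsMarkovKernel (eulerKernel h b σ) :=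
  Kernel.IsMarkovKernel.map _ hm

lemma continuous_eulerMap {h : ℝ} {b : EuclideanSpace ℝ (Fin d) → EuclideanSpace ℝ (Fin d)}
    {σ : EuclideanSpace ℝ (Fin d) → Matrix (Fin d) (Fin m) ℝ} (hb : Continuous b)
    (hσ : Continuous σ) :
    Continuous fun p : EuclideanSpace ℝ (Fin d) × EuclideanSpace ℝ (Fin m) =>
      eulerMap h b σ p.1 p.2 := by
  have h1 : Continuous fun p : EuclideanSpace ℝ (Fin d) × EuclideanSpace ℝ (Fin m) =>
      toEuclideanLin (σ p.1) p.2 := by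
    simp only [toLpLin_apply]
    refine (PiLp.continuous_toLp 2 _).comp (Continuous.matrix_mulVec (by fun_prop) ?_)
    exact (PiLp.continuous_ofLp 2 _).comp continuous_snd
  unfold eulerMap
  fun_prop

lemma continuous_of_hsNormSq_sub_le {σ : EuclideanSpace ℝ (Fin d) → Matrix (Fin d) (Fin m) ℝ}
    {c : ℝ} (h : ∀ x y, hsNormSq (σ x - σ y) ≤ c * ‖x - y‖ ^ 2) : Continuous σ := by
  refine continuous_matrix fun i j => ?_
  refine (LipschitzWith.of_dist_le_mul (K := (√|c|).toNNReal) fun x y => ?_).continuous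
  rw [Real.coe_toNNReal _ (Real.sqrt_nonneg _), Real.dist_eq, dist_eq_norm]
  refine abs_le_of_sq_le_sq ?_ (by positivity)
  rw [mul_pow, Real.sq_sqrt (abs_nonneg _)]
  have h1 : (σ x i j - σ y i j) ^ 2 ≤ hsNormSq (σ x - σ y) := by
    rw [hsNormSq]
    exact (Finset.single_le_sum (f := fun j => (σ x - σ y) i j ^ 2) (fun _ _ => sq_nonneg _)
      (Finset.mem_univ j)).trans (Finset.single_le_sum (f := fun i => ∑ j, (σ x - σ y) i j ^ 2)
        (fun _ _ => Finset.sum_nonneg fun _ _ => sq_nonneg _) (Finset.mem_univ i))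
  exact h1.trans ((h x y).trans (mul_le_mul_of_nonneg_right (le_abs_self c) (sq_nonneg _)))

lemma integral_eulerKernel {h : ℝ} {b : EuclideanSpace ℝ (Fin d) → EuclideanSpace ℝ (Fin d)}
    {σ : EuclideanSpace ℝ (Fin d) → Matrix (Fin d) (Fin m) ℝ}
    (hm : Measurable fun p : EuclideanSpace ℝ (Fin d) × EuclideanSpace ℝ (Fin m) =>
      eulerMap h b σ p.1 p.2) {x : EuclideanSpace ℝ (Fin d)} {S : Matrix (Fin d) (Fin d) ℝ}
    (hS : S * Sᵀ = σ x * (σ x)ᵀ) {f : EuclideanSpace ℝ (Fin d) → ℝ} (hf : Measurable f) :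
    ∫ z, f z ∂(eulerKernel h b σ x) =
      ∫ v, f (x + h • b x + √h • toEuclideanLin S v) ∂(stdGaussian (EuclideanSpace ℝ (Fin d))) := by
  have hlin {k : ℕ} (A : Matrix (Fin d) (Fin k) ℝ) : Measurable (toEuclideanLin A) :=
    (toEuclideanLin A).continuous_of_finiteDimensional.measurable
  have haff : Measurable fun z => f (x + h • b x + √h • z) := hf.comp (by fun_prop)
  have hσm := hlin (σ x)
  have hSm := hlin S
  have hx : Measurable (eulerMap h b σ x) := hm.comp measurable_prodMk_left
  rw [eulerKernel_apply hm, integral_map hx.aemeasurable hf.aestronglyMeasurable]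
  have e := congrArg (fun μ => ∫ z, f (x + h • b x + √h • z) ∂μ)
    (stdGaussian_map_toEuclideanLin_eq hS)
  simp only at e
  rw [integral_map hSm.aemeasurable haff.aestronglyMeasurable,
    integral_map hσm.aemeasurable haff.aestronglyMeasurable] at e
  exact e.symm

lemma det_toEuclideanLin (A : Matrix (Fin d) (Fin d) ℝ) :
    LinearMap.det (toEuclideanLin A) = A.det := by
  rw [toEuclideanLin, toLpLin_eq_toLin, LinearMap.det_toLin]

lemma toEuclideanLin_mul_apply {k : ℕ} (A : Matrix (Fin d) (Fin m) ℝ)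
    (B : Matrix (Fin m) (Fin k) ℝ) (v : EuclideanSpace ℝ (Fin k)) :
    toEuclideanLin (A * B) v = toEuclideanLin A (toEuclideanLin B v) := by
  simp [toLpLin_apply, mulVec_mulVec]

lemma norm_sq_toEuclideanLin_le {A : Matrix (Fin d) (Fin m) ℝ} {c : ℝ} (hA : SqOpBound A c)
    (v : EuclideanSpace ℝ (Fin m)) : ‖toEuclideanLin A v‖ ^ 2 ≤ c * ‖v‖ ^ 2 := by
  rw [EuclideanSpace.real_norm_sq_eq, EuclideanSpace.real_norm_sq_eq]
  simpa [dotProduct, sq] using hA v.ofLp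

/-- One step of the Euler scheme, in terms of the means and the diffusion coefficients. -/
theorem integral_eulerKernel_le {h : ℝ} (hh : 0 < h)
    {b : EuclideanSpace ℝ (Fin d) → EuclideanSpace ℝ (Fin d)}
    {σ : EuclideanSpace ℝ (Fin d) → Matrix (Fin d) (Fin m) ℝ}
    (hm : Measurable fun p : EuclideanSpace ℝ (Fin d) × EuclideanSpace ℝ (Fin m) =>
      eulerMap h b σ p.1 p.2) {lam Lam : ℝ} (hlam : 0 < lam) (hle : lam ≤ Lam)
    (h_ell : ∀ x, (σ x * (σ x)ᵀ - lam • (1 : Matrix (Fin d) (Fin d) ℝ)).PosSemidef)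
    (h_bdd : ∀ x, (Lam • (1 : Matrix (Fin d) (Fin d) ℝ) - σ x * (σ x)ᵀ).PosSemidef)
    {f : EuclideanSpace ℝ (Fin d) → ℝ} (hf : Measurable f) {K : ℝ} (hfK : ∀ z, |f z| ≤ K)
    (x y : EuclideanSpace ℝ (Fin d)) :
    ∫ z, f z ∂(eulerKernel h b σ x) ≤ Real.log (∫ z, Real.exp (f z) ∂(eulerKernel h b σ y)) +
      (‖x - y + h • (b x - b y)‖ ^ 2 / (2 * h * lam) +
        (Lam / lam) ^ 2 / lam * hsNormSq (σ x - σ y)) := by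
  obtain ⟨S, hS⟩ := exists_mul_transpose_eq (σ x)
  obtain ⟨R, hR⟩ := exists_mul_transpose_eq (σ y)
  have hRl := le_transpose_mulVec_of_posSemidef (hR ▸ h_ell y)
  have hSl := le_transpose_mulVec_of_posSemidef (hS ▸ h_ell x)
  have hRdet := det_ne_zero_of_le_transpose_mulVec hlam hRl
  have hSdet := det_ne_zero_of_le_transpose_mulVec hlam hSl
  have hdet : (R⁻¹ * S).det ≠ 0 := by
    rw [det_mul, det_nonsing_inv, Ring.inverse_eq_inv']
    exact mul_ne_zero (inv_ne_zero hRdet) hSdet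
  have hRR (v : EuclideanSpace ℝ (Fin d)) : toEuclideanLin R (toEuclideanLin R⁻¹ v) = v := by
    rw [← toEuclideanLin_mul_apply, mul_nonsing_inv _ hRdet.isUnit]
    simp
  have hsq : 0 < √h := Real.sqrt_pos.2 hh
  -- In the noise coordinate of the step from `y`, the step from `x` is the affine image `c + R⁻¹ S
  -- v` of a standard Gaussian.
  set c := (√h)⁻¹ • toEuclideanLin R⁻¹ (x - y + h • (b x - b y)) with hc
  set G : EuclideanSpace ℝ (Fin d) → ℝ :=
    fun v => f (y + h • b y + √h • toEuclideanLin R v) with hG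
  have hRm : Measurable (toEuclideanLin R) :=
    (toEuclideanLin R).continuous_of_finiteDimensional.measurable
  have hGm : Measurable G := hf.comp (by fun_prop)
  have key := integral_affine_le_log_integral_exp (A := toEuclideanLin (R⁻¹ * S))
    (by rwa [det_toEuclideanLin]) c hGm (fun v => hfK _)
  have hGc (v : EuclideanSpace ℝ (Fin d)) : G (c + toEuclideanLin (R⁻¹ * S) v) =
      f (x + h • b x + √h • toEuclideanLin S v) := by
    simp only [hG, hc]
    rw [map_add, map_smul, hRR, toEuclideanLin_mul_apply, hRR, smul_add, smul_inv_smul₀ hsq.ne']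
    congr 1
    module
  have h1 : ∫ v, ‖v‖ ^ 2 ∂(stdGaussian (EuclideanSpace ℝ (Fin d))) = d := by
    have := integral_norm_sq_affine_stdGaussian (1 : Matrix (Fin d) (Fin d) ℝ) 0
    simpa [hsNormSq_one] using this
  simp_rw [hGc] at key
  rw [← integral_eulerKernel hm hS hf, integral_norm_sq_affine_stdGaussian, h1,
    det_toEuclideanLin] at key
  rw [integral_eulerKernel hm hR (f := fun z => Real.exp (f z)) (by fun_prop)]
  have hcov := hsNormSq_inv_mul_sub_log_det_le hlam hle hS hR (h_ell x) (h_ell y) (h_bdd x)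
    (h_bdd y)
  have hmean : ‖c‖ ^ 2 ≤ ‖x - y + h • (b x - b y)‖ ^ 2 / (h * lam) := by
    have := norm_sq_toEuclideanLin_le (.inv hlam hRl) (x - y + h • (b x - b y))
    rw [hc, norm_smul, mul_pow, norm_inv, Real.norm_of_nonneg hsq.le, inv_pow,
      Real.sq_sqrt hh.le]
    calc _ ≤ h⁻¹ * (lam⁻¹ * ‖x - y + h • (b x - b y)‖ ^ 2) := by gcongr
      _ = _ := by field_simp
  refine key.trans (add_le_add le_rfl ?_)
  have : ‖x - y + h • (b x - b y)‖ ^ 2 / (2 * h * lam) =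
      ‖x - y + h • (b x - b y)‖ ^ 2 / (h * lam) / 2 := by
    field_simp
  rw [this]
  linarith

/-- Expand the square; `h_contr` is used with weight `2h` and the square of `h_lip` with weight
`h²`. -/
lemma norm_sq_add_smul_le {h α β : ℝ} (hh : 0 < h) {s : ℝ}
    {u w : EuclideanSpace ℝ (Fin d)} (h_contr : inner ℝ w u + 1 / 2 * s ≤ -α * ‖u‖ ^ 2)
    (h_lip : ‖w‖ ≤ β * ‖u‖) :
    ‖u + h • w‖ ^ 2 + h * s ≤ eulerLSq α β h * ‖u‖ ^ 2 := by
  rw [norm_add_sq_real, norm_smul, real_inner_smul_right, real_inner_comm, eulerLSq,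
    Real.norm_of_nonneg hh.le]
  have h1 : ‖w‖ ^ 2 ≤ (β * ‖u‖) ^ 2 := by gcongr
  nlinarith [mul_le_mul_of_nonneg_left h1 (sq_nonneg h), mul_le_mul_of_nonneg_left h_contr hh.le]

/-- By Cauchy–Schwarz the drift term is at least `-β ‖u‖²`. This makes `σ` Lipschitz, controls the
covariance cost, and forces `α ≤ β` in positive dimension. -/
lemma half_le_sub_mul_norm_sq {α β s : ℝ} {u w : EuclideanSpace ℝ (Fin d)}
    (h_contr : inner ℝ w u + 1 / 2 * s ≤ -α * ‖u‖ ^ 2) (h_lip : ‖w‖ ≤ β * ‖u‖) :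
    1 / 2 * s ≤ (β - α) * ‖u‖ ^ 2 := by
  have h1 := neg_le_of_abs_le (abs_real_inner_le_norm w u)
  have h2 := mul_le_mul_of_nonneg_right h_lip (norm_nonneg u)
  nlinarith

theorem sqContraction_eulerKernel {h α β : ℝ} (hh : 0 < h)
    {b : EuclideanSpace ℝ (Fin d) → EuclideanSpace ℝ (Fin d)}
    {σ : EuclideanSpace ℝ (Fin d) → Matrix (Fin d) (Fin m) ℝ}
    (hm : Measurable fun p : EuclideanSpace ℝ (Fin d) × EuclideanSpace ℝ (Fin m) =>
      eulerMap h b σ p.1 p.2)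
    (h_contr : ∀ x y, inner ℝ (b x - b y) (x - y) + 1 / 2 * hsNormSq (σ x - σ y) ≤
      -α * ‖x - y‖ ^ 2)
    (h_lip : ∀ x y, ‖b x - b y‖ ≤ β * ‖x - y‖) :
    SqContraction (eulerKernel h b σ) (eulerLSq α β h) := by
  intro x y
  have hx : Measurable (eulerMap h b σ x) := hm.comp measurable_prodMk_left
  have hy : Measurable (eulerMap h b σ y) := hm.comp measurable_prodMk_left
  have hxy : Measurable fun v => (eulerMap h b σ x v, eulerMap h b σ y v) := hx.prodMk hy
  have hdiff (v) : eulerMap h b σ x v - eulerMap h b σ y v =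
      (x - y + h • (b x - b y)) + toEuclideanLin (√h • (σ x - σ y)) v := by
    simp only [eulerMap, map_smul, map_sub, LinearMap.smul_apply, LinearMap.sub_apply]
    module
  have hmeas : Measurable fun p : EuclideanSpace ℝ (Fin d) × EuclideanSpace ℝ (Fin d) =>
      ‖p.1 - p.2‖ ^ 2 := by fun_prop
  -- Synchronous coupling: both copies use the same noise `v`.
  refine ⟨(stdGaussian (EuclideanSpace ℝ (Fin m))).map
    fun v => (eulerMap h b σ x v, eulerMap h b σ y v), ?_, ?_, ?_, ?_⟩
  · rw [Measure.map_map measurable_fst hxy, eulerKernel_apply hm]; rfl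
  · rw [Measure.map_map measurable_snd hxy, eulerKernel_apply hm]; rfl
  · rw [integrable_map_measure hmeas.aestronglyMeasurable hxy.aemeasurable]
    simp only [Function.comp_def, hdiff]
    exact integrable_norm_sq_affine_stdGaussian _ _
  · rw [integral_map hxy.aemeasurable hmeas.aestronglyMeasurable]
    simp only [hdiff]
    rw [integral_norm_sq_affine_stdGaussian, hsNormSq_smul, Real.sq_sqrt hh.le]
    exact norm_sq_add_smul_le hh (h_contr x y) (h_lip x y)

/-- The log-Harnack constant of one Euler step. -/
noncomputable def eulerStepConst (α β lam Lam h : ℝ) : ℝ :=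
  (eulerLSq α β h + 4 * (β - α) * (Lam / lam) ^ 3 * h) / (2 * h * lam)

theorem boundedLogHarnack_eulerKernel {h α β : ℝ} (hh : 0 < h)
    {b : EuclideanSpace ℝ (Fin d) → EuclideanSpace ℝ (Fin d)}
    {σ : EuclideanSpace ℝ (Fin d) → Matrix (Fin d) (Fin m) ℝ}
    (hm : Measurable fun p : EuclideanSpace ℝ (Fin d) × EuclideanSpace ℝ (Fin m) =>
      eulerMap h b σ p.1 p.2) {lam Lam : ℝ} (hlam : 0 < lam) (hle : lam ≤ Lam)
    (h_contr : ∀ x y, inner ℝ (b x - b y) (x - y) + 1 / 2 * hsNormSq (σ x - σ y) ≤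
      -α * ‖x - y‖ ^ 2)
    (h_ell : ∀ x, (σ x * (σ x)ᵀ - lam • (1 : Matrix (Fin d) (Fin d) ℝ)).PosSemidef)
    (h_lip : ∀ x y, ‖b x - b y‖ ≤ β * ‖x - y‖)
    (h_bdd : ∀ x, (Lam • (1 : Matrix (Fin d) (Fin d) ℝ) - σ x * (σ x)ᵀ).PosSemidef) :
    BoundedLogHarnack (eulerKernel h b σ) (eulerStepConst α β lam Lam h) := by
  intro f K hf h0 hK x y
  refine (integral_eulerKernel_le hh hm hlam hle h_ell h_bdd hf
    (fun z => (abs_of_nonneg (h0 z)).trans_le (hK z)) x y).trans ?_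
  rw [add_comm]
  refine add_le_add ?_ le_rfl
  set r := Lam / lam with hr
  have hr1 : 1 ≤ r := (one_le_div hlam).2 hle
  set s := hsNormSq (σ x - σ y)
  have hs0 : 0 ≤ s := hsNormSq_nonneg _
  have h1 := norm_sq_add_smul_le hh (h_contr x y) (h_lip x y)
  have h2 := half_le_sub_mul_norm_sq (h_contr x y) (h_lip x y)
  -- The divergence bound has only `r²`; the cube is the weaker stated constant, allowed by `r ≥ 1`.
  have h3 : r ^ 2 * s ≤ r ^ 3 * (2 * ((β - α) * ‖x - y‖ ^ 2)) := by
    have : r ^ 2 ≤ r ^ 3 := pow_le_pow_right₀ hr1 (by norm_num)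
    exact mul_le_mul this (by linarith) hs0 (by positivity)
  -- The nonnegative term `h * s` in `h1` is dropped.
  calc _ ≤ eulerLSq α β h * ‖x - y‖ ^ 2 / (2 * h * lam) +
        r ^ 3 * (2 * ((β - α) * ‖x - y‖ ^ 2)) / lam := by
        rw [div_mul_eq_mul_div]
        gcongr
        nlinarith
    _ = _ := by
        rw [eulerStepConst, ← hr]
        field_simp
        ring

end Euler

/-! ### Identification of the constants and conclusion. -/

section MainTheorem

lemma eulerKernelIter_eq_kernelIter {d m : ℕ} (h : ℝ)
    (b : ℝ → EuclideanSpace ℝ (Fin d) → EuclideanSpace ℝ (Fin d))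
    (σ : ℝ → EuclideanSpace ℝ (Fin d) → Matrix (Fin d) (Fin m) ℝ) (n : ℕ) :
    eulerKernelIter h b σ n = kernelIter (fun i => eulerKernel h (b (i * h)) (σ (i * h))) n := by
  induction n with
  | zero => rfl
  | succ n ih => rw [eulerKernelIter, kernelIter, ih]

/-- On a one-point space the quadratic term vanishes, so the sign of `C` plays no role. This case is
separate because `α ≤ β` and `λ ≤ Λ` need a nonzero vector. -/
lemma logHarnack_of_dim_zero {P : Kernel (EuclideanSpace ℝ (Fin 0)) (EuclideanSpace ℝ (Fin 0))}
    [IsMarkovKernel P] (C : ℝ) : LogHarnack P C := by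
  refine BoundedLogHarnack.logHarnack fun f K _ _ _ x y => ?_
  have hf : f = fun _ => f x := funext fun z => congrArg f (Subsingleton.elim z x)
  rw [hf, Subsingleton.elim y x]
  simp

/-- `L² = (1 - β h)² + 2 h (β - α)`. -/
lemma eulerLSq_nonneg {α β h : ℝ} (hh : 0 < h) (hαβ : α ≤ β) : 0 ≤ eulerLSq α β h := by
  unfold eulerLSq
  nlinarith [sq_nonneg (1 - β * h), mul_le_mul_of_nonneg_right hαβ hh.le]

lemma eulerStepConst_nonneg {α β lam Lam h : ℝ} (hh : 0 < h) (hlam : 0 < lam) (hLam : 0 < Lam)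
    (hαβ : α ≤ β) : 0 ≤ eulerStepConst α β lam Lam h := by
  have := eulerLSq_nonneg hh hαβ
  have := sub_nonneg.2 hαβ
  unfold eulerStepConst
  positivity

/-- Both nonnegative terms of `L² = (1 - β h)² + 2 h (β - α)` vanish, so `α = β` and the covariance
cost disappears too. -/
lemma eulerStepConst_eq_zero {α β lam Lam h : ℝ} (hh : 0 < h) (hαβ : α ≤ β)
    (hL : eulerLSq α β h = 0) : eulerStepConst α β lam Lam h = 0 := by
  have h1 : 2 * h * (β - α) + (1 - β * h) ^ 2 = 0 := by
    unfold eulerLSq at hL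
    linarith
  have h2 : β - α = 0 := by
    have := mul_nonneg hh.le (sub_nonneg.2 hαβ)
    have h3 : h * (β - α) = 0 := by nlinarith [sq_nonneg (1 - β * h)]
    exact (mul_eq_zero.1 h3).resolve_left hh.ne'
  simp [eulerStepConst, hL, h2]

lemma eulerStepConst_div_geom_sum {α β lam Lam h : ℝ} (hh : 0 < h) (hlam : 0 < lam)
    (hL : eulerLSq α β h ≠ 0) (N : ℕ) :
    eulerStepConst α β lam Lam h / ∑ i ∈ Finset.range N, (eulerLSq α β h)⁻¹ ^ i =
      logHarnackConst α β lam Lam h N := by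
  rw [logHarnackConst, if_neg hL, eulerStepConst]
  split_ifs with h1
  · simp only [h1, inv_one, one_pow, Finset.sum_const, Finset.card_range, nsmul_eq_mul, mul_one,
      div_div, mul_one_div]
    congr 1
    ring
  · have hα : α - β ^ 2 * h / 2 = (1 - eulerLSq α β h) / (2 * h) := by
      rw [eulerLSq]; field_simp; ring
    rw [geom_sum_eq (by simpa using h1), hα, inv_pow]
    generalize (eulerLSq α β h ^ N)⁻¹ - 1 = g
    generalize eulerLSq α β h = q at *
    field_simp

/-- The numerators differ by `β h (β - α) / 2 ≥ 0`, and `L² < 1` makes the denominator nonnegative.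
-/
lemma logHarnackConst_le_logHarnackConst' {α β lam Lam h : ℝ} (hh : 0 < h) (hβ : 0 < β)
    (hlam : 0 < lam) (hLam : 0 < Lam) (hαβ : α ≤ β) (hL0 : 0 < eulerLSq α β h)
    (hL1 : eulerLSq α β h < 1) (N : ℕ) :
    logHarnackConst α β lam Lam h N ≤ logHarnackConst' α β lam Lam h N := by
  rw [logHarnackConst, if_neg hL0.ne', if_neg hL1.ne, logHarnackConst']
  have h1 : 0 ≤ (eulerLSq α β h ^ N)⁻¹ - 1 :=
    sub_nonneg.2 ((one_le_inv₀ (by positivity)).2 (pow_le_one₀ hL0.le hL1.le))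
  have := sub_nonneg.2 hαβ
  gcongr
  nlinarith [mul_nonneg (mul_nonneg hβ.le hh.le) this]

end MainTheorem

theorem mainTheorem12 {d m : ℕ} (N : ℕ) (hN : 1 ≤ N) (h : ℝ) (hh : 0 < h)
    (b : ℝ → EuclideanSpace ℝ (Fin d) → EuclideanSpace ℝ (Fin d))
    (σ : ℝ → EuclideanSpace ℝ (Fin d) → Matrix (Fin d) (Fin m) ℝ)
    (α β lam Lam : ℝ) (hβ : 0 < β) (hlam : 0 < lam) (hLam : 0 < Lam)
    (h_contr : ∀ t ∈ Set.Icc (0 : ℝ) (N * h), ∀ x y : EuclideanSpace ℝ (Fin d),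
      inner ℝ (b t x - b t y) (x - y) + 1 / 2 * hsNormSq (σ t x - σ t y) ≤ -α * ‖x - y‖ ^ 2)
    (h_ell : ∀ t ∈ Set.Icc (0 : ℝ) (N * h), ∀ x : EuclideanSpace ℝ (Fin d),
      (σ t x * (σ t x).transpose - lam • (1 : Matrix (Fin d) (Fin d) ℝ)).PosSemidef)
    (h_lip : ∀ t ∈ Set.Icc (0 : ℝ) (N * h), ∀ x y : EuclideanSpace ℝ (Fin d),
      ‖b t x - b t y‖ ≤ β * ‖x - y‖)
    (h_bdd : ∀ t ∈ Set.Icc (0 : ℝ) (N * h), ∀ x : EuclideanSpace ℝ (Fin d),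
      (Lam • (1 : Matrix (Fin d) (Fin d) ℝ) - σ t x * (σ t x).transpose).PosSemidef) :
    LogHarnack (eulerKernelIter h b σ N) (logHarnackConst α β lam Lam h N) ∧
      (0 < eulerLSq α β h → eulerLSq α β h < 1 →
        LogHarnack (eulerKernelIter h b σ N) (logHarnackConst' α β lam Lam h N)) := by
  have hmem : ∀ i < N, (i * h : ℝ) ∈ Set.Icc (0 : ℝ) (N * h) := fun i hi =>
    ⟨by positivity, mul_le_mul_of_nonneg_right (Nat.cast_le.2 hi.le) hh.le⟩
  have hmeas : ∀ i < N, Measurable fun p : EuclideanSpace ℝ (Fin d) × EuclideanSpace ℝ (Fin m) =>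
      eulerMap h (b (i * h)) (σ (i * h)) p.1 p.2 := by
    intro i hi
    refine (continuous_eulerMap ?_ ?_).measurable
    · exact (LipschitzWith.of_dist_le_mul (K := β.toNNReal) fun x y => by
        rw [Real.coe_toNNReal _ hβ.le, dist_eq_norm, dist_eq_norm]
        exact h_lip _ (hmem i hi) x y).continuous
    · refine continuous_of_hsNormSq_sub_le (c := 2 * (β - α)) fun x y => ?_
      have := half_le_sub_mul_norm_sq (h_contr _ (hmem i hi) x y) (h_lip _ (hmem i hi) x y)
      linarith
  have hM : ∀ i < N, IsMarkovKernel (eulerKernel h (b (i * h)) (σ (i * h))) :=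
    fun i hi => isMarkovKernel_eulerKernel (hmeas i hi)
  have hMN : IsMarkovKernel (eulerKernelIter h b σ N) := by
    rw [eulerKernelIter_eq_kernelIter]
    exact isMarkovKernel_kernelIter hM
  rcases Nat.eq_zero_or_pos d with rfl | hd
  · exact ⟨logHarnack_of_dim_zero _, fun _ _ => logHarnack_of_dim_zero _⟩
  -- Testing the hypotheses at time `0` on a unit vector gives `α ≤ β` and `λ ≤ Λ`.
  let e : EuclideanSpace ℝ (Fin d) := EuclideanSpace.single ⟨0, hd⟩ 1
  have he : ‖e‖ = 1 := by simp [e]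
  have hαβ : α ≤ β := by
    have h1 := half_le_sub_mul_norm_sq (h_contr _ (hmem 0 hN) e 0) (h_lip _ (hmem 0 hN) e 0)
    rw [sub_zero, he] at h1
    have h2 := (mul_nonneg (by norm_num : (0 : ℝ) ≤ 1 / 2) (hsNormSq_nonneg _)).trans h1
    linarith
  have hle : lam ≤ Lam := by
    have h1 := le_transpose_mulVec_of_posSemidef (h_ell _ (hmem 0 hN) 0) e.ofLp
    have h2 := (SqOpBound.of_posSemidef hLam.le (h_bdd _ (hmem 0 hN) 0)).transpose hLam.le e.ofLp
    have h3 : dotProduct e.ofLp e.ofLp = 1 := by simp [e]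
    rw [h3] at h1 h2
    linarith
  have hH : ∀ i < N, BoundedLogHarnack (eulerKernel h (b (i * h)) (σ (i * h)))
      (eulerStepConst α β lam Lam h) := fun i hi =>
    boundedLogHarnack_eulerKernel hh (hmeas i hi) hlam hle (h_contr _ (hmem i hi))
      (h_ell _ (hmem i hi)) (h_lip _ (hmem i hi)) (h_bdd _ (hmem i hi))
  have hq : ∀ i < N, SqContraction (eulerKernel h (b (i * h)) (σ (i * h))) (eulerLSq α β h) :=
    fun i hi => sqContraction_eulerKernel hh (hmeas i hi) (h_contr _ (hmem i hi))
      (h_lip _ (hmem i hi))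
  have hC := eulerStepConst_nonneg hh hlam hLam hαβ
  have main : LogHarnack (eulerKernelIter h b σ N) (logHarnackConst α β lam Lam h N) := by
    refine BoundedLogHarnack.logHarnack ?_
    rw [eulerKernelIter_eq_kernelIter]
    obtain ⟨n, rfl⟩ := Nat.exists_eq_add_of_le' hN
    by_cases hL : eulerLSq α β h = 0
    · rw [logHarnackConst, if_pos hL, ← eulerStepConst_eq_zero (lam := lam) (Lam := Lam) hh hαβ hL]
      exact BoundedLogHarnack.kernelIter_same hC n hM hH hq
    · rw [← eulerStepConst_div_geom_sum hh hlam hL]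
      exact BoundedLogHarnack.kernelIter ((eulerLSq_nonneg hh hαβ).lt_of_ne' hL) hC n hM hH hq
  exact ⟨main, fun hL0 hL1 =>
    main.mono (logHarnackConst_le_logHarnackConst' hh hβ hlam hLam hαβ hL0 hL1 N)⟩
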